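/- Let $\mathcal P=\{I,X,Y,Z\}$ and let $\mathcal C=\mathcal P\cdot\{I,H,S,HS,SHS,(HS)^2\}$ be the set of the $24$ single-qubit Clifford gates (modulo global phase). Fix any injective encoding of $\mathcal C$ by $5$-bit strings. The gate-teleportation circuit $\mathsf{Telep}_n$ takes as input an encoded tuple $(C_0,\dots,C_{n-1})\in\mathcal C^n$ and acts on $2n$ qubits that start in $|0\rangle$. It prepares $n$ Bell states $|\Phi\rangle_{a_jb_j}=\frac1{\sqrt2}(|00\rangle+|11\rangle)$, applies $C_j$ to $b_j$ for every $j$, and then, for every $j$ (indices modulo $n$), makes a Bell measurement on $b_j$ and $a_{j+1}$ (a CNOT with control $b_j$ and target $a_{j+1}$, a Hadamard gate on $b_j$, and a measurement of both qubits in the computational basis). The two outcome bits $(z_j,x_j)$ encode the Pauli $P_j\in\mathcal P$ equal to $Z^{z_j}X^{x_j}$ up to a phase. The circuit consists of $5$ layers of one- and two-qubit gates, each controlled by at most $5$ classical input bits. Let $p(P_0,\dots,P_{n-1}\mid C_0,\dots,C_{n-1})$ be its output distribution. The possibilistic simulation problem $\mathsf{PSIM}[\mathsf{Telep}]$ asks,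 on input $(C_0,\dots,C_{n-1})$, to output the $2n$ bits that encode some $(P_0,\dots,P_{n-1})$ with $p(P_0,\dots,P_{n-1}\mid C_0,\dots,C_{n-1})>0$. (i) The quantum circuit $\mathsf{Telep}_n$ solves this problem: for every $n$ and every instance in $\mathcal C^n$ its output is valid with probability $1$. (ii) Let $(\mathsf F_n)_{n}$ be any (possibly non-uniform) family of classical Boolean circuits, $\mathsf F_n$ with $5n$ input and $2n$ output bits, of depth at most a constant $d$ and with arbitrary Boolean gates of fan-in at most a constant $\nu$. Then there are an $n$ and an instance $(C_0,\dots,C_{n-1})\in\mathcal C^n$ on which the output of $\mathsf F_n$ is not valid. In particular, no non-uniform $\mathsf{NC}^0$ circuit (constant depth, bounded fan-in, polynomial size) solves $\mathsf{PSIM}[\mathsf{Telep}]$ on all instances. -/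

import Mathlib

noncomputable section

namespace GateTeleportation

/-! ### Quantum circuits with classical control

Qubits are labelled by a finite type `W`, classical input bits by a type `ι`; the computational
basis of the qubits is `W → Bool`. -/

/-- A classically controlled one- or two-qubit gate: the values of the input bits listed in
`control` select the unitary that is applied to the qubits listed in `wire`. -/
structure QGate (ι W : Type) where
  arity : ℕ
  one_le_arity : 1 ≤ arity
  arity_le_two : arity ≤ 2
  wire : Fin arity ↪ W
  numControls : ℕ
  control : Fin numControls → ι
  op : (Fin numControls → Bool) → Matrix (Fin arity → Bool) (Fin arity → Bool) ℂ
  op_unitary : ∀ b, op b ∈ Matrix.unitaryGroup (Fin arity → Bool) ℂ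

/-- A circuit layer: gates acting in parallel on pairwise disjoint sets of qubits. -/
structure QLayer (ι W : Type) where
  numGates : ℕ
  gate : Fin numGates → QGate ι W
  disjoint : ∀ k l, k ≠ l → ∀ i j, (gate k).wire i ≠ (gate l).wire j

/-- A quantum circuit, as the list of its layers in the order of application. -/
structure QCircuit (ι W : Type) where
  layers : List (QLayer ι W)

/-- The unitary of a layer on input `I`: the tensor product of its gates with the identity on
the qubits that no gate touches. -/
def QLayer.unitary {ι W : Type} (L : QLayer ι W) (I : ι → Bool) :
    Matrix (W → Bool) (W → Bool) ℂ :=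
  open Classical in
  fun x y =>
    if ∀ q : W, (∀ k i, (L.gate k).wire i ≠ q) → x q = y q then
      ∏ k, (L.gate k).op (fun c => I ((L.gate k).control c))
        (fun i => x ((L.gate k).wire i)) (fun i => y ((L.gate k).wire i))
    else 0

section

variable {ι W : Type} [Fintype W] [DecidableEq W]

/-- The basis state in which all qubits are zero. -/
def zeroState (W : Type) [Fintype W] [DecidableEq W] : (W → Bool) → ℂ :=
  Pi.single (fun _ => false) 1

/-- The state obtained from the all-zero state by applying all layers, on input `I`. -/
def QCircuit.finalState (Q : QCircuit ι W) (I : ι → Bool) : (W → Bool) → ℂ :=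
  Q.layers.foldl (fun ψ L => (L.unitary I).mulVec ψ) (zeroState W)

/-- The conditional output distribution `p(O | I)`: the probability that measuring all qubits in
the computational basis yields `O`, on input `I`. -/
def QCircuit.outputProb (Q : QCircuit ι W) (I : ι → Bool) (O : W → Bool) : ℝ :=
  ‖Q.finalState I O‖ ^ 2

/-- The possibilistic simulation problem of `Q`, as a relation: `O` is a valid output for the
instance `I` if it occurs with nonzero probability. -/
def PSIM (Q : QCircuit ι W) (I : ι → Bool) (O : W → Bool) : Prop :=
  0 < Q.outputProb I O

/-- On instance `I`, the (random) output of `Q` is in relation `R` to `I` with probability one. -/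
def QCircuit.SolvesOn (Q : QCircuit ι W) (R : (ι → Bool) → (W → Bool) → Prop)
    (I : ι → Bool) : Prop :=
  open Classical in
  (∑ O : W → Bool, Q.outputProb I O = 1) ∧ (∑ O with R I O, Q.outputProb I O) = 1

/-- Circuit depth. -/
def QCircuit.depth (Q : QCircuit ι W) : ℕ := Q.layers.length

/-- Every gate is controlled by at most `c` input bits. -/
def QCircuit.ControlBound (Q : QCircuit ι W) (c : ℕ) : Prop :=
  ∀ L ∈ Q.layers, ∀ k, (L.gate k).numControls ≤ c

end

/-! ### Single-qubit Clifford gates -/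

/-- The matrix with rows `a b` and `c d`. -/
def mat2 (a b c d : ℂ) : Matrix Bool Bool ℂ :=
  Matrix.of fun i j => match i, j with
    | false, false => a
    | false, true => b
    | true, false => c
    | true, true => d

/-- Hadamard gate. -/
def hGate : Matrix Bool Bool ℂ :=
  mat2 (1 / (Real.sqrt 2 : ℂ)) (1 / (Real.sqrt 2 : ℂ))
    (1 / (Real.sqrt 2 : ℂ)) (-(1 / (Real.sqrt 2 : ℂ)))

/-- Phase gate. -/
def sGate : Matrix Bool Bool ℂ := mat2 1 0 0 Complex.I

/-- Labels of the Pauli matrices. -/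
inductive Pauli
  | I | X | Y | Z
  deriving DecidableEq

instance : Fintype Pauli := ⟨{.I, .X, .Y, .Z}, fun P => by cases P <;> simp⟩

/-- The Pauli matrices. -/
def Pauli.toMatrix : Pauli → Matrix Bool Bool ℂ
  | .I => mat2 1 0 0 1
  | .X => mat2 0 1 1 0
  | .Y => mat2 0 (-Complex.I) Complex.I 0
  | .Z => mat2 1 0 0 (-1)

/-- Labels of the coset representatives `I, H, S, HS, SHS, (HS)²` of the single-qubit Clifford
group modulo the Pauli group. -/
inductive CliffordRep
  | I | H | S | HS | SHS | HSHS
  deriving DecidableEq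

instance : Fintype CliffordRep := ⟨{.I, .H, .S, .HS, .SHS, .HSHS}, fun K => by cases K <;> simp⟩

/-- The coset representatives as matrices. -/
def CliffordRep.toMatrix : CliffordRep → Matrix Bool Bool ℂ
  | .I => 1
  | .H => hGate
  | .S => sGate
  | .HS => hGate * sGate
  | .SHS => sGate * hGate * sGate
  | .HSHS => (hGate * sGate) ^ 2

/-- The 24 single-qubit Clifford gates (modulo global phases), as products of a Pauli and a coset
representative. -/
abbrev Clifford : Type := Pauli × CliffordRep

/-- The unitary matrix of a Clifford gate. -/
def Clifford.toMatrix (c : Clifford) : Matrix Bool Bool ℂ := c.1.toMatrix * c.2.toMatrix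

theorem hGate_unitary : hGate ∈ Matrix.unitaryGroup Bool ℂ := by
  have h : ((Real.sqrt 2 : ℝ) : ℂ)⁻¹ * ((Real.sqrt 2 : ℝ) : ℂ)⁻¹ = 1 / 2 := by
    rw [← mul_inv, ← Complex.ofReal_mul, Real.mul_self_sqrt (by norm_num)]; norm_num
  rw [Matrix.mem_unitaryGroup_iff]
  ext i j
  cases i <;> cases j <;>
    simp [hGate, mat2, Matrix.mul_apply, Matrix.star_apply, h] <;> norm_num

theorem sGate_unitary : sGate ∈ Matrix.unitaryGroup Bool ℂ := by
  rw [Matrix.mem_unitaryGroup_iff]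
  ext i j
  cases i <;> cases j <;>
    simp [sGate, mat2, Matrix.mul_apply, Matrix.star_apply]

theorem Pauli.toMatrix_unitary (P : Pauli) : P.toMatrix ∈ Matrix.unitaryGroup Bool ℂ := by
  rw [Matrix.mem_unitaryGroup_iff]
  ext i j
  cases P <;> cases i <;> cases j <;>
    simp [Pauli.toMatrix, mat2, Matrix.mul_apply, Matrix.star_apply]

theorem Clifford.toMatrix_unitary (c : Clifford) :
    c.toMatrix ∈ Matrix.unitaryGroup Bool ℂ := by
  have hhs := mul_mem hGate_unitary sGate_unitary
  refine mul_mem (Pauli.toMatrix_unitary _) ?_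
  rcases c with ⟨P, K⟩
  cases K
  · exact one_mem _
  · exact hGate_unitary
  · exact sGate_unitary
  · exact hhs
  · exact mul_mem (mul_mem sGate_unitary hGate_unitary) sGate_unitary
  · exact pow_mem hhs 2

/-! ### The gate-teleportation circuit -/

/-- A `2 × 2` matrix, as an operator on a register of one qubit. -/
def oneQubit (U : Matrix Bool Bool ℂ) : Matrix (Fin 1 → Bool) (Fin 1 → Bool) ℂ :=
  fun x y => U (x 0) (y 0)

/-- The controlled NOT on a register of two qubits (qubit `0` controls, qubit `1` is the
target). -/
def cnot : Matrix (Fin 2 → Bool) (Fin 2 → Bool) ℂ :=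
  fun x y => if x 0 = y 0 ∧ x 1 = (y 0 ^^ y 1) then 1 else 0

theorem oneQubit_unitary {U : Matrix Bool Bool ℂ} (hU : U ∈ Matrix.unitaryGroup Bool ℂ) :
    oneQubit U ∈ Matrix.unitaryGroup (Fin 1 → Bool) ℂ := by
  rw [Matrix.mem_unitaryGroup_iff] at hU ⊢
  ext x y
  have h := congrFun (congrFun hU (x 0)) (y 0)
  have hxy : x = y ↔ x 0 = y 0 :=
    ⟨fun h => by rw [h], fun h => funext fun i => by rw [Subsingleton.elim i 0]; exact h⟩
  rw [Matrix.mul_apply, ← (Equiv.funUnique (Fin 1) Bool).symm.sum_comp]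
  rw [Matrix.mul_apply] at h
  simpa [oneQubit, Matrix.star_apply, Matrix.one_apply, hxy] using h

theorem cnot_unitary : cnot ∈ Matrix.unitaryGroup (Fin 2 → Bool) ℂ := by
  rw [Matrix.mem_unitaryGroup_iff]
  ext x y
  have hxy : x = y ↔ x 0 = y 0 ∧ x 1 = y 1 := by
    rw [funext_iff, Fin.forall_fin_two]
  rw [Matrix.mul_apply, ← (finTwoArrowEquiv Bool).symm.sum_comp, Fintype.sum_prod_type]
  simp only [cnot, Matrix.star_apply, Matrix.one_apply, hxy]
  cases x 0 <;> cases x 1 <;> cases y 0 <;> cases y 1 <;> simp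

/-- The one-qubit gate `U` on qubit `q`, without classical control. -/
def gate1 {ι W : Type} (U : Matrix Bool Bool ℂ) (hU : U ∈ Matrix.unitaryGroup Bool ℂ) (q : W) :
    QGate ι W where
  arity := 1
  one_le_arity := le_refl 1
  arity_le_two := one_le_two
  wire := ⟨fun _ => q, fun _ _ _ => Subsingleton.elim _ _⟩
  numControls := 0
  control := Fin.elim0
  op := fun _ => oneQubit U
  op_unitary := fun _ => oneQubit_unitary hU

/-- The CNOT gate with control qubit `q` and target qubit `r`, without classical control. -/
def gateCNOT {ι W : Type} (q r : W) (h : q ≠ r) : QGate ι W where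
  arity := 2
  one_le_arity := one_le_two
  arity_le_two := le_refl 2
  wire := ⟨![q, r], by
    intro i j hij
    fin_cases i <;> fin_cases j <;> simp_all⟩
  numControls := 0
  control := Fin.elim0
  op := fun _ => cnot
  op_unitary := fun _ => cnot_unitary

/-- The unitary selected by a `5`-bit string: the Clifford gate that it encodes, and the identity
if it encodes none. -/
def decodeClifford (e : Clifford ↪ (Fin 5 → Bool)) : (Fin 5 → Bool) → Matrix Bool Bool ℂ :=
  Function.extend e Clifford.toMatrix (fun _ => 1)

theorem decodeClifford_unitary (e : Clifford ↪ (Fin 5 → Bool)) (b : Fin 5 → Bool) :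
    decodeClifford e b ∈ Matrix.unitaryGroup Bool ℂ := by
  by_cases h : ∃ c, e c = b
  · obtain ⟨c, rfl⟩ := h
    rw [decodeClifford, e.injective.extend_apply]
    exact Clifford.toMatrix_unitary c
  · rw [decodeClifford, Function.extend_apply' _ _ _ h]
    exact one_mem _

/-- The Clifford gate encoded by the five bits of the `j`-th input block, applied to qubit `q`. -/
def gateClifford {n : ℕ} {W : Type} (e : Clifford ↪ (Fin 5 → Bool)) (j : Fin n) (q : W) :
    QGate (Fin n × Fin 5) W where
  arity := 1
  one_le_arity := le_refl 1
  arity_le_two := one_le_two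
  wire := ⟨fun _ => q, fun _ _ _ => Subsingleton.elim _ _⟩
  numControls := 5
  control := fun c => (j, c)
  op := fun b => oneQubit (decodeClifford e b)
  op_unitary := fun b => oneQubit_unitary (decodeClifford_unitary e b)

/-- The `2n` qubits of the teleportation circuit. The `j`-th Bell measurement is made on the qubits
`(j, 0)` and `(j, 1)`; the `j`-th Bell state is prepared on the qubits `(j - 1, 1)` and `(j, 0)`,
indices modulo `n`. -/
abbrev TelepQubit (n : ℕ) : Type := Fin n × Fin 2

/-- The partner `(j - 1, 1)` of the qubit `(j, 0)` in the `j`-th Bell state. -/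
def partner {n : ℕ} (j : Fin n) : TelepQubit n := ((finRotate n).symm j, 1)

theorem partner_ne {n : ℕ} (i j : Fin n) : partner i ≠ (j, 0) := by
  simp [partner]

theorem partner_injective {n : ℕ} : Function.Injective (partner (n := n)) := by
  intro i j h
  exact (finRotate n).symm.injective (congrArg Prod.fst h)

/-- The first layer: Hadamard gates on the qubits `(j - 1, 1)`. -/
def prepH (n : ℕ) : QLayer (Fin n × Fin 5) (TelepQubit n) where
  numGates := n
  gate := fun j => gate1 hGate hGate_unitary (partner j)
  disjoint := fun _ _ h _ _ h' => h (partner_injective h')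

/-- The second layer: CNOT gates from `(j - 1, 1)` to `(j, 0)`; with the first layer, they create
the `n` Bell states `(|00⟩ + |11⟩) / √2`. -/
def prepCNOT (n : ℕ) : QLayer (Fin n × Fin 5) (TelepQubit n) where
  numGates := n
  gate := fun j => gateCNOT (partner j) (j, 0) (partner_ne j j)
  disjoint := by
    intro k l h i j
    have h1 := partner_ne k l
    have h2 := partner_ne l k
    have h3 : partner k ≠ partner l := fun h' => h (partner_injective h')
    have key : ∀ i j : Fin 2, (![partner k, (k, 0)] : Fin 2 → TelepQubit n) i ≠
        (![partner l, (l, 0)] : Fin 2 → TelepQubit n) j := by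
      simp only [Fin.forall_fin_two]
      exact ⟨⟨h3, h1⟩, h2.symm, fun h' => h (congrArg Prod.fst h')⟩
    exact key i j

/-- The third layer: the `j`-th input Clifford is applied to one half of the `j`-th Bell state. -/
def cliffordLayer (e : Clifford ↪ (Fin 5 → Bool)) (n : ℕ) :
    QLayer (Fin n × Fin 5) (TelepQubit n) where
  numGates := n
  gate := fun j => gateClifford e j (j, 0)
  disjoint := fun _ _ h _ _ h' => h (congrArg Prod.fst h')

/-- The fourth layer: CNOT gates from `(j, 0)` to `(j, 1)`. -/
def measureCNOT (n : ℕ) : QLayer (Fin n × Fin 5) (TelepQubit n) where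
  numGates := n
  gate := fun j => gateCNOT (j, 0) (j, 1) (by simp)
  disjoint := by
    intro k l h i j
    have key : ∀ i j : Fin 2, (![(k, 0), (k, 1)] : Fin 2 → TelepQubit n) i ≠
        (![(l, 0), (l, 1)] : Fin 2 → TelepQubit n) j := by
      simp [Fin.forall_fin_two, h]
    exact key i j

/-- The fifth layer: Hadamard gates on the qubits `(j, 0)`. -/
def measureH (n : ℕ) : QLayer (Fin n × Fin 5) (TelepQubit n) where
  numGates := n
  gate := fun j => gate1 hGate hGate_unitary (j, 0)
  disjoint := fun _ _ h _ _ h' => h (congrArg Prod.fst h')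

/-- The single-qubit Clifford gate-teleportation circuit: preparation of `n` Bell states, the
Clifford gates, and `n` Bell measurements (each one a CNOT, a Hadamard gate and the measurement of
both qubits in the computational basis). The outcome bits `(z, x)` of the qubits `(j, 0), (j, 1)`
are the encoding of the `j`-th output Pauli: they mean that these qubits were projected onto the
Bell state `(ZᶻXˣ ⊗ I) (|00⟩ + |11⟩) / √2`, up to a sign, and `00, 01, 10, 11` stand for
`I, X, Z, Y`. -/
def telep (e : Clifford ↪ (Fin 5 → Bool)) (n : ℕ) :
    QCircuit (Fin n × Fin 5) (TelepQubit n) where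
  layers := [prepH n, prepCNOT n, cliffordLayer e n, measureCNOT n, measureH n]

/-- The bit string that encodes an `n`-tuple of Clifford gates. -/
def encode (e : Clifford ↪ (Fin 5 → Bool)) {n : ℕ} (C : Fin n → Clifford) :
    Fin n × Fin 5 → Bool :=
  fun p => e (C p.1) p.2

/-! ### Classical circuits -/

/-- A Boolean circuit with input bits `ι` and output bits `o`. Gates are numbered in a topological
order; the arguments of a gate are input bits or values of gates with smaller number, and a gate
computes an arbitrary Boolean function of its arguments. -/
structure BoolCircuit (ι o : Type) where
  size : ℕ
  fanIn : Fin size → ℕ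
  arg : (g : Fin size) → Fin (fanIn g) → ι ⊕ Fin (g : ℕ)
  op : (g : Fin size) → (Fin (fanIn g) → Bool) → Bool
  out : o → ι ⊕ Fin size

namespace BoolCircuit

variable {ι o : Type}

/-- The value of gate `g` on input `x`. -/
def gateVal (C : BoolCircuit ι o) (x : ι → Bool) (g : Fin C.size) : Bool :=
  C.op g fun i => match C.arg g i with
    | .inl j => x j
    | .inr h => C.gateVal x ⟨h, h.2.trans g.2⟩
termination_by (g : ℕ)
decreasing_by exact h.2

/-- The output of the circuit on input `x`. -/
def eval (C : BoolCircuit ι o) (x : ι → Bool) : o → Bool :=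
  fun k => Sum.elim x (C.gateVal x) (C.out k)

/-- The length of a longest path that ends in gate `g`, where input bits have depth `0`. -/
def gateDepth (C : BoolCircuit ι o) (g : Fin C.size) : ℕ :=
  1 + Finset.univ.sup fun i => match C.arg g i with
    | .inl _ => 0
    | .inr h => C.gateDepth ⟨h, h.2.trans g.2⟩
termination_by (g : ℕ)
decreasing_by exact h.2

/-- Circuit depth. -/
def depth (C : BoolCircuit ι o) : ℕ := Finset.univ.sup C.gateDepth

end BoolCircuit

/-- A (possibly non-uniform) family of circuits has constant depth and bounded fan-in. -/
def ConstDepthBoundedFanIn {ι o : ℕ → Type} (F : ∀ n, BoolCircuit (ι n) (o n)) : Prop :=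
  ∃ d ν : ℕ, ∀ n, (F n).depth ≤ d ∧ ∀ g, (F n).fanIn g ≤ ν

/-- A (possibly non-uniform) family of circuits is an `NC⁰` circuit: it has constant depth, bounded
fan-in and polynomial size. -/
def IsNC0 {ι o : ℕ → Type} (F : ∀ n, BoolCircuit (ι n) (o n)) : Prop :=
  ConstDepthBoundedFanIn F ∧ ∃ p : Polynomial ℕ, ∀ n, (F n).size ≤ p.eval n

end GateTeleportation

end

open GateTeleportation

/-! Part (i) only uses that layers are unitary: the output probabilities sum to 1, and `PSIM`
excludes only outcomes of probability 0.

For part (ii), `telep_finalState` writes the amplitude of an outcome as a sum over closed walks, so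
by `PSIM_telep_iff` an output is valid iff the trace of the ordered product of the matrices `C_k^T
Z^{z_k} X^{x_k}` is nonzero. Put one of `I, HS, (HS)²` at position `p`, one of `H, S, SHS` at `q >
p`, and identities elsewhere. Moving all Paulis to the right turns validity into one linear
condition over `ZMod 2` on the outcomes (`testForm_sum_magicAction`), one for each of the nine pairs
`(a, b)`.

Add the nine equations. The right-hand sides sum to 1. If each outcome ignores the gate at `p` or
the gate at `q`, its contributions on the left cancel (`sum_left_testForm`, `sum_right_testForm`), a
contradiction. Bounded depth and fan-in make each outcome depend on boundedly many input blocks, so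
for large `n` a counting argument (`exists_lt_not_mem_of_card_le`) finds `p` and `q` that no outcome
sees together. -/

noncomputable section
namespace GateTeleportation

/-! ### Unitarity of layers, and part (i) -/

section

/-- The qubits that no gate of the layer touches. -/
def QLayer.Untouched {ι W : Type} (L : QLayer ι W) : Type :=
  {q : W // ∀ k i, (L.gate k).wire i ≠ q}

/-- The qubits, split into the untouched ones and the registers of the gates. -/
def QLayer.splitQubits {ι W : Type} (L : QLayer ι W) :
    L.Untouched ⊕ (Σ k, Fin (L.gate k).arity) ≃ W :=
  Equiv.ofBijective (Sum.elim Subtype.val fun s => (L.gate s.1).wire s.2) <| by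
    refine ⟨Function.Injective.sumElim Subtype.val_injective ?_ fun a b h => a.2 b.1 b.2 h.symm, ?_⟩
    · rintro ⟨k, i⟩ ⟨l, j⟩ h
      obtain rfl : k = l := by
        by_contra hkl
        exact L.disjoint k l hkl i j h
      exact congrArg (Sigma.mk k) ((L.gate k).wire.injective h)
    · intro q
      by_cases hq : ∀ k i, (L.gate k).wire i ≠ q
      · exact ⟨.inl ⟨q, hq⟩, rfl⟩
      · push Not at hq
        obtain ⟨k, i, h⟩ := hq
        exact ⟨.inr ⟨k, i⟩, h⟩

/-- Basis states, split into those of the untouched qubits and of the registers of the gates. -/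
def QLayer.splitBasis {ι W : Type} (L : QLayer ι W) :
    (W → Bool) ≃ (L.Untouched → Bool) × (∀ k, Fin (L.gate k).arity → Bool) :=
  (L.splitQubits.arrowCongr (Equiv.refl Bool)).symm.trans <|
    (Equiv.sumArrowEquivProdArrow _ _ _).trans <|
      (Equiv.refl _).prodCongr (Equiv.piCurry fun _ _ => Bool)

open Classical in
theorem QLayer.unitary_apply {ι W : Type} (L : QLayer ι W) (I : ι → Bool) (x y : W → Bool) :
    L.unitary I x y = (if (L.splitBasis x).1 = (L.splitBasis y).1 then 1 else 0) *
      ∏ k, (L.gate k).op (fun c => I ((L.gate k).control c))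
        ((L.splitBasis x).2 k) ((L.splitBasis y).2 k) := by
  have h : (∀ q : W, (∀ k i, (L.gate k).wire i ≠ q) → x q = y q) ↔
      (L.splitBasis x).1 = (L.splitBasis y).1 :=
    ⟨fun h => funext fun q => h q.1 q.2, fun h q hq => congrFun h ⟨q, hq⟩⟩
  rw [QLayer.unitary]
  simp only [h, ite_mul, one_mul, zero_mul]
  rfl

variable {ι W : Type} [Fintype W] [DecidableEq W]

/-- In the coordinates of `splitBasis` the layer is the tensor product of an identity with the
gates, so orthonormality of its rows follows factor by factor. -/
theorem QLayer.unitary_mem_unitaryGroup (L : QLayer ι W) (I : ι → Bool) :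
    L.unitary I ∈ Matrix.unitaryGroup (W → Bool) ℂ := by
  classical
  have : Fintype L.Untouched := by unfold QLayer.Untouched; infer_instance
  rw [Matrix.mem_unitaryGroup_iff]
  ext x y
  rw [Matrix.mul_apply, ← L.splitBasis.symm.sum_comp, Fintype.sum_prod_type]
  simp only [Matrix.star_apply, QLayer.unitary_apply, Equiv.apply_symm_apply, star_mul',
    star_prod]
  have hop : ∀ k, ∑ z, (L.gate k).op (fun c => I ((L.gate k).control c)) ((L.splitBasis x).2 k) z *
      star ((L.gate k).op (fun c => I ((L.gate k).control c)) ((L.splitBasis y).2 k) z) =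
      if (L.splitBasis x).2 k = (L.splitBasis y).2 k then 1 else 0 := fun k => by
    have h := congrFun (congrFun (Matrix.mem_unitaryGroup_iff.1
      ((L.gate k).op_unitary fun c => I ((L.gate k).control c))) ((L.splitBasis x).2 k))
      ((L.splitBasis y).2 k)
    rw [Matrix.mul_apply, Matrix.one_apply] at h
    exact h
  -- Distributivity: a sum over joint register states of a product over gates is the product of the
  -- sums for the single gates, each known by `hop`.
  have hsum := (Fintype.prod_sum fun k z =>
    (L.gate k).op (fun c => I ((L.gate k).control c)) ((L.splitBasis x).2 k) z *
      star ((L.gate k).op (fun c => I ((L.gate k).control c)) ((L.splitBasis y).2 k) z)).symm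
  simp only [hop] at hsum
  calc _ = ∑ z₁ : L.Untouched → Bool, (if (L.splitBasis x).1 = z₁ then (1 : ℂ) else 0) *
        ((if (L.splitBasis y).1 = z₁ then (1 : ℂ) else 0) *
        ∏ k, if (L.splitBasis x).2 k = (L.splitBasis y).2 k then (1 : ℂ) else 0) := by
        refine Finset.sum_congr rfl fun z₁ _ => ?_
        rw [← hsum, Finset.mul_sum, Finset.mul_sum]
        refine Finset.sum_congr rfl fun z₂ _ => ?_
        rw [Finset.prod_mul_distrib, apply_ite star, star_one, star_zero]
        ring
    _ = _ := by
        have hxy : x = y ↔ (L.splitBasis y).1 = (L.splitBasis x).1 ∧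
            ∀ k, (L.splitBasis x).2 k = (L.splitBasis y).2 k := by
          rw [← L.splitBasis.injective.eq_iff, Prod.ext_iff, funext_iff (f := (L.splitBasis x).2),
            eq_comm (a := (L.splitBasis x).1)]
        simp only [ite_mul, one_mul, zero_mul, Finset.sum_ite_eq, Finset.mem_univ, if_true]
        simp only [Fintype.prod_ite_zero, Finset.prod_const_one, Matrix.one_apply, hxy, ite_and]

theorem sum_norm_sq_mulVec {n : Type*} [Fintype n] [DecidableEq n] {U : Matrix n n ℂ}
    (hU : U ∈ Matrix.unitaryGroup n ℂ) (ψ : n → ℂ) :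
    ∑ x, ‖U.mulVec ψ x‖ ^ 2 = ∑ x, ‖ψ x‖ ^ 2 := by
  have key : ∀ φ : n → ℂ, ((∑ x, ‖φ x‖ ^ 2 : ℝ) : ℂ) = star φ ⬝ᵥ φ := fun φ => by
    rw [Complex.ofReal_sum]
    refine Finset.sum_congr rfl fun x _ => ?_
    rw [Pi.star_apply, Complex.ofReal_pow, ← Complex.conj_mul']
    rfl
  apply Complex.ofReal_injective
  rw [key, key, Matrix.star_mulVec, Matrix.dotProduct_mulVec, Matrix.vecMul_vecMul,
    ← Matrix.star_eq_conjTranspose, Matrix.mem_unitaryGroup_iff'.1 hU, Matrix.vecMul_one]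

theorem QCircuit.sum_outputProb (Q : QCircuit ι W) (I : ι → Bool) :
    ∑ O, Q.outputProb I O = 1 := by
  have key : ∀ (l : List (QLayer ι W)) (ψ : (W → Bool) → ℂ),
      ∑ O, ‖l.foldl (fun ψ L => (L.unitary I).mulVec ψ) ψ O‖ ^ 2 = ∑ O, ‖ψ O‖ ^ 2 := by
    intro l
    induction l with
    | nil => intro ψ; rfl
    | cons L l ih =>
      intro ψ
      rw [List.foldl_cons, ih, sum_norm_sq_mulVec (L.unitary_mem_unitaryGroup I)]
  refine (key Q.layers (zeroState W)).trans ?_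
  rw [Finset.sum_eq_single fun _ => false]
  · simp [zeroState]
  · intro O _ hO
    simp [zeroState, hO]
  · simp

open Classical in
/-- Every quantum circuit solves its own possibilistic simulation problem. -/
theorem QCircuit.solvesOn_PSIM (Q : QCircuit ι W) (I : ι → Bool) : Q.SolvesOn (PSIM Q) I := by
  refine ⟨Q.sum_outputProb I, ?_⟩
  rw [Finset.sum_filter_of_ne, Q.sum_outputProb I]
  intro O _ hO
  exact lt_of_le_of_ne (sq_nonneg _) (Ne.symm hO)

theorem telep_controlBound (e : Clifford ↪ (Fin 5 → Bool)) (n : ℕ) :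
    (telep e n).ControlBound 5 := by
  intro L hL k
  simp only [telep, List.mem_cons, List.not_mem_nil, or_false] at hL
  rcases hL with rfl | rfl | rfl | rfl | rfl
  exacts [Nat.zero_le 5, Nat.zero_le 5, le_refl 5, Nat.zero_le 5, Nat.zero_le 5]

end

/-! ### Pauli labels and their transport through Clifford gates -/

/-- The phase space of a qubit: the pair `(x, z)` labels the Pauli matrix `ZᶻXˣ`. -/
abbrev PauliIndex : Type := ZMod 2 × ZMod 2

/-- The matrix `ZᶻXˣ`. -/
def pauliMatrix (v : PauliIndex) : Matrix Bool Bool ℂ :=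
  mat2 1 0 0 (-1) ^ v.2.val * mat2 0 1 1 0 ^ v.1.val

theorem pauliMatrix_zero_zero : pauliMatrix (0, 0) = mat2 1 0 0 1 := by
  ext i j
  cases i <;> cases j <;> simp [pauliMatrix, mat2]

theorem pauliMatrix_one_zero : pauliMatrix (1, 0) = mat2 0 1 1 0 := by
  ext i j
  cases i <;> cases j <;> simp [pauliMatrix, mat2, ZMod.val_one]

theorem pauliMatrix_zero_one : pauliMatrix (0, 1) = mat2 1 0 0 (-1) := by
  ext i j
  cases i <;> cases j <;> simp [pauliMatrix, mat2, ZMod.val_one]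

theorem pauliMatrix_one_one : pauliMatrix (1, 1) = mat2 0 1 (-1) 0 := by
  ext i j
  cases i <;> cases j <;> simp [pauliMatrix, mat2, ZMod.val_one, Matrix.mul_apply]

theorem mat2_mul (a b c d a' b' c' d' : ℂ) : mat2 a b c d * mat2 a' b' c' d' =
    mat2 (a * a' + b * c') (a * b' + b * d') (c * a' + d * c') (c * b' + d * d') := by
  ext i j
  cases i <;> cases j <;> simp [mat2, Matrix.mul_apply, add_comm]

theorem smul_mat2 (t a b c d : ℂ) : t • mat2 a b c d = mat2 (t * a) (t * b) (t * c) (t * d) := by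
  ext i j
  cases i <;> cases j <;> simp [mat2]

theorem transpose_mat2 (a b c d : ℂ) : (mat2 a b c d).transpose = mat2 a c b d := by
  ext i j
  cases i <;> cases j <;> simp [mat2]

theorem trace_mat2 (a b c d : ℂ) : (mat2 a b c d).trace = a + d := by
  simp [mat2, Matrix.trace, add_comm]

theorem PauliIndex.forall {p : PauliIndex → Prop} :
    (∀ v, p v) ↔ p (0, 0) ∧ p (0, 1) ∧ p (1, 0) ∧ p (1, 1) := by
  refine ⟨fun h => ⟨h _, h _, h _, h _⟩, fun ⟨h0, h1, h2, h3⟩ ⟨x, z⟩ => ?_⟩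
  fin_cases x <;> fin_cases z
  exacts [h0, h1, h2, h3]

theorem pauliMatrix_mul (v w : PauliIndex) :
    ∃ c : ℂ, pauliMatrix v * pauliMatrix w = c • pauliMatrix (v + w) := by
  have h2 : (1 + 1 : ZMod 2) = 0 := rfl
  -- Restricting the scalar to an explicit finite list leaves a finite check on 2 × 2 matrices; the
  -- same device serves for `hGate` and `sGate`.
  have key : ∀ v w : PauliIndex, pauliMatrix v * pauliMatrix w = (1 : ℂ) • pauliMatrix (v + w) ∨
      pauliMatrix v * pauliMatrix w = (-1 : ℂ) • pauliMatrix (v + w) := by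
    simp only [PauliIndex.forall, Prod.mk_add_mk, h2, add_zero, zero_add, pauliMatrix_zero_zero,
      pauliMatrix_zero_one, pauliMatrix_one_zero, pauliMatrix_one_one, mat2_mul, smul_mat2]
    norm_num
  rcases key v w with h | h
  exacts [⟨_, h⟩, ⟨_, h⟩]

/-- Pauli matrices can be commuted from the left to the right of `E`, up to scalars, if their labels
are transformed by `R`. -/
def CommutesPauli (E : Matrix Bool Bool ℂ) (R : PauliIndex →+ PauliIndex) : Prop :=
  ∀ v, ∃ c : ℂ, pauliMatrix v * E = c • (E * pauliMatrix (R v))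

theorem CommutesPauli.one : CommutesPauli 1 (AddMonoidHom.id _) :=
  fun v => ⟨1, by simp⟩

theorem CommutesPauli.mul {E F : Matrix Bool Bool ℂ} {R T : PauliIndex →+ PauliIndex}
    (hE : CommutesPauli E R) (hF : CommutesPauli F T) : CommutesPauli (E * F) (T.comp R) := by
  intro v
  obtain ⟨c, hc⟩ := hE v
  obtain ⟨d, hd⟩ := hF (R v)
  refine ⟨c * d, ?_⟩
  rw [← mul_assoc, hc, Matrix.smul_mul, mul_assoc, hd, Matrix.mul_smul, smul_smul, ← mul_assoc,
    AddMonoidHom.comp_apply]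

/-- The action of the Hadamard gate on Pauli labels. -/
def hAction : PauliIndex →+ PauliIndex :=
  (AddMonoidHom.snd _ _).prod (AddMonoidHom.fst _ _)

/-- The action of the phase gate on Pauli labels. -/
def sAction : PauliIndex →+ PauliIndex :=
  (AddMonoidHom.fst _ _).prod (AddMonoidHom.fst _ _ + AddMonoidHom.snd _ _)

theorem commutesPauli_hGate : CommutesPauli hGate hAction := by
  have key : ∀ v, ∃ c : ℂ, (c = 1 ∨ c = -1) ∧
      pauliMatrix v * hGate = c • (hGate * pauliMatrix (hAction v)) := by
    simp only [PauliIndex.forall, hAction, AddMonoidHom.prod_apply, AddMonoidHom.coe_fst,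
      AddMonoidHom.coe_snd, pauliMatrix_zero_zero, hGate, or_and_right, exists_or, exists_eq_left,
      pauliMatrix_zero_one, pauliMatrix_one_zero, pauliMatrix_one_one, mat2_mul, smul_mat2]
    simp
  exact fun v => (key v).imp fun c h => h.2

theorem commutesPauli_sGate : CommutesPauli sGate sAction := by
  have key : ∀ v, ∃ c : ℂ, (c = 1 ∨ c = Complex.I ∨ c = -Complex.I) ∧
      pauliMatrix v * sGate = c • (sGate * pauliMatrix (sAction v)) := by
    have h2 : (1 + 1 : ZMod 2) = 0 := rfl
    simp only [PauliIndex.forall, sAction, AddMonoidHom.prod_apply, AddMonoidHom.coe_fst,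
      AddMonoidHom.add_apply, h2, zero_add, add_zero,
      AddMonoidHom.coe_snd, pauliMatrix_zero_zero, sGate, or_and_right, exists_or, exists_eq_left,
      pauliMatrix_zero_one, pauliMatrix_one_zero, pauliMatrix_one_one, mat2_mul, smul_mat2]
    simp
  exact fun v => (key v).imp fun c h => h.2

/-- Collecting the Pauli matrices of a product on the right; `D j` is the product of the matrices
`E j, E (j + 1), …`. -/
theorem prod_mul_pauliMatrix {n : ℕ} (E : Fin n → Matrix Bool Bool ℂ) (P : Fin n → PauliIndex)
    (D : Fin (n + 1) → Matrix Bool Bool ℂ) (R : Fin n → PauliIndex →+ PauliIndex)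
    (hlast : D (Fin.last n) = 1) (hD : ∀ j, D j.castSucc = E j * D j.succ)
    (hR : ∀ j, CommutesPauli (D j.succ) (R j)) :
    ∃ c : ℂ, (List.ofFn fun j => E j * pauliMatrix (P j)).prod =
      c • (D 0 * pauliMatrix (∑ j, R j (P j))) := by
  induction n with
  | zero =>
    refine ⟨1, ?_⟩
    have h0 : D 0 = 1 := hlast
    simp only [List.ofFn_zero, List.prod_nil, h0, Finset.univ_eq_empty, Finset.sum_empty, one_mul,
      one_smul, Prod.zero_eq_mk, pauliMatrix_zero_zero]
    ext i j
    cases i <;> cases j <;> simp [mat2]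
  | succ n ih =>
    obtain ⟨c, hc⟩ := ih (fun j => E j.succ) (fun j => P j.succ) (fun j => D j.succ)
      (fun j => R j.succ) (by rw [← hlast]; rfl) (fun j => hD j.succ) fun j => hR j.succ
    -- The first Pauli is moved past the whole tail product and then merged with the Pauli already
    -- collected from the tail.
    obtain ⟨d, hd⟩ := hR 0 (P 0)
    obtain ⟨f, hf⟩ := pauliMatrix_mul (R 0 (P 0)) (∑ j : Fin n, R j.succ (P j.succ))
    refine ⟨c * (d * f), ?_⟩
    have h0 : D 0 = E 0 * D (Fin.succ 0) := hD 0
    rw [List.ofFn_succ, List.prod_cons, hc, Fin.sum_univ_succ, Matrix.mul_smul, mul_assoc,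
      ← mul_assoc (pauliMatrix (P 0)), hd, Matrix.smul_mul, Matrix.mul_smul, mul_assoc (D _), hf,
      Matrix.mul_smul, Matrix.mul_smul, ← mul_assoc (E 0), h0, smul_smul, smul_smul, mul_assoc c]

/-! ### The nine gate pairs and their linear tests -/

/-- The transposes of the Clifford gates `I, HS, (HS)²`. -/
def rotationGate : Fin 3 → Matrix Bool Bool ℂ :=
  ![1, sGate * hGate, sGate * hGate * (sGate * hGate)]

/-- The Clifford gates `H, S, SHS`, which equal their transposes. -/
def reflectionGate : Fin 3 → Matrix Bool Bool ℂ :=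
  ![hGate, sGate, sGate * hGate * sGate]

/-- The action of `rotationGate` on Pauli labels. -/
def rotationAction : Fin 3 → PauliIndex →+ PauliIndex :=
  ![.id _, hAction.comp sAction, (hAction.comp sAction).comp (hAction.comp sAction)]

/-- The action of `reflectionGate` on Pauli labels. -/
def reflectionAction : Fin 3 → PauliIndex →+ PauliIndex :=
  ![hAction, sAction, sAction.comp (hAction.comp sAction)]

theorem commutesPauli_rotationGate (a : Fin 3) :
    CommutesPauli (rotationGate a) (rotationAction a) := by
  have h := commutesPauli_sGate.mul commutesPauli_hGate
  fin_cases a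
  exacts [.one, h, h.mul h]

theorem commutesPauli_reflectionGate (b : Fin 3) :
    CommutesPauli (reflectionGate b) (reflectionAction b) := by
  fin_cases b
  exacts [commutesPauli_hGate, commutesPauli_sGate,
    (commutesPauli_sGate.mul commutesPauli_hGate).mul commutesPauli_sGate]

/-- The linear form on Pauli labels that is tested on the instance `(a, b)`. -/
def testForm (a b : Fin 3) : PauliIndex →+ ZMod 2 :=
  ![AddMonoidHom.fst _ _ + AddMonoidHom.snd _ _, AddMonoidHom.fst _ _, AddMonoidHom.snd _ _] (a + b)

/-- The value that the linear form `testForm a b` must have. -/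
def testValue (a b : Fin 3) : ZMod 2 := if a + b = 0 then 1 else 0

theorem hGate_eq_smul : hGate = (1 / (Real.sqrt 2 : ℂ)) • mat2 1 1 1 (-1) := by
  rw [hGate, smul_mat2, mul_one, mul_neg, mul_one]

/-- Since `(SH)³` is a scalar, `rotationGate a * reflectionGate b` is proportional to
`reflectionGate (a + b)`. Each of `H, S, SHS` is a combination of just two Paulis: `X, Z` for `H`;
`I, Z` for `S`; `I, X` for `SHS`. Their labels form the lines `x + z = 1`, `x = 0` and `z = 0`. -/
theorem testForm_eq_of_trace_ne_zero (a b : Fin 3) (v : PauliIndex)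
    (h : (rotationGate a * reflectionGate b * pauliMatrix v).trace ≠ 0) :
    testForm a b v = testValue a b := by
  contrapose! h
  revert v
  rw [PauliIndex.forall]
  fin_cases a <;> fin_cases b <;> refine ⟨?_, ?_, ?_, ?_⟩ <;>
    -- Labels on the line satisfy the equation; for the others the trace is computed and vanishes.
    first
    | exact fun h => absurd (by decide) h
    | intro _
      simp only [rotationGate, reflectionGate, hGate_eq_smul, sGate, pauliMatrix_zero_zero,
        pauliMatrix_zero_one, pauliMatrix_one_zero, pauliMatrix_one_one, mat2_mul,
        Matrix.smul_mul, Matrix.mul_smul, smul_smul, Matrix.trace_smul, trace_mat2, one_mul,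
        Fin.zero_eta, Fin.mk_one, Fin.reduceFinMk, Matrix.cons_val, smul_eq_mul]
      simp [mul_add, add_mul, mul_assoc] <;> ring

/-- Three cells of the square have `a + b = 0`, an odd number. -/
theorem testValue_sum : ∑ a, ∑ b, testValue a b = 1 := by decide

/-- Along a row or column of the square the forms are `x + z`, `x`, `z` in some order, with sum
zero. The joint action of rotation and reflection leaves `testForm a b` invariant, so the same
cancellation survives for an outcome measured before, between or after the two gates. -/
theorem sum_left_testForm (b : Fin 3) (v : PauliIndex) :
    ∑ a, testForm a b v = 0 ∧ ∑ a, testForm a b (reflectionAction b v) = 0 ∧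
      ∑ a, testForm a b (reflectionAction b (rotationAction a v)) = 0 := by
  revert b v; decide

theorem sum_right_testForm (a : Fin 3) (v : PauliIndex) :
    ∑ b, testForm a b v = 0 ∧ ∑ b, testForm a b (reflectionAction b v) = 0 ∧
      ∑ b, testForm a b (reflectionAction b (rotationAction a v)) = 0 := by
  revert a v; decide

/-! ### Output amplitudes of the teleportation circuit as traces -/

/-- The sum over all closed paths of the products of matrix entries is the trace of the product. -/
theorem sum_prod_cycle_eq_trace {m : ℕ} {α R : Type*} [Fintype α] [DecidableEq α] [CommRing R]
    (M : Fin (m + 1) → Matrix α α R) :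
    ∑ v : Fin (m + 1) → α, ∏ k, M k (v ((finRotate (m + 1)).symm k)) (v k) =
      (List.ofFn M).prod.trace := by
  -- Open walks from `a`, weighted by `f` at their end, are suited to induction; taking `f` to be
  -- the indicator of `a` closes them.
  have path : ∀ (n : ℕ) (M : Fin n → Matrix α α R) (f : α → R) (a : α),
      (List.ofFn M).prod.mulVec f a = ∑ v : Fin n → α,
        (∏ k, M k (Fin.cons (α := fun _ => α) a v k.castSucc) (v k)) *
          f (Fin.cons (α := fun _ => α) a v (Fin.last n)) := by
    intro n
    induction n with
    | zero => intro M f a; simp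
    | succ n ih =>
      intro M f a
      rw [List.ofFn_succ, List.prod_cons, ← Matrix.mulVec_mulVec, Matrix.mulVec, dotProduct,
        ← (Fin.consEquiv fun _ => α).sum_comp, Fintype.sum_prod_type]
      refine Finset.sum_congr rfl fun b _ => ?_
      rw [ih, Finset.mul_sum]
      refine Finset.sum_congr rfl fun v _ => ?_
      rw [Fin.prod_univ_succ, ← mul_assoc]
      rfl
  have hrot : ∀ (v : Fin (m + 1) → α) (k : Fin (m + 1)),
      Fin.cons (α := fun _ => α) (v (Fin.last m)) v k.castSucc =
        v ((finRotate (m + 1)).symm k) := by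
    intro v k
    obtain ⟨j, rfl⟩ := (finRotate (m + 1)).surjective k
    rw [Equiv.symm_apply_apply]
    refine Fin.lastCases ?_ (fun i => ?_) j
    · rw [finRotate_last]; rfl
    · rw [finRotate_apply, Fin.coeSucc_eq_succ]; rfl
  have diag : ∀ a, (List.ofFn M).prod a a = ∑ v : Fin (m + 1) → α,
      if v (Fin.last m) = a then ∏ k, M k (v ((finRotate (m + 1)).symm k)) (v k) else 0 := by
    intro a
    have h := path (m + 1) M (Pi.single a 1) a
    rw [Matrix.mulVec_single_one] at h
    refine h.trans (Finset.sum_congr rfl fun v _ => ?_)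
    have hl : Fin.cons (α := fun _ => α) a v (Fin.last (m + 1)) = v (Fin.last m) := rfl
    rw [hl, Pi.single_apply, mul_ite, mul_one, mul_zero]
    refine if_ctx_congr Iff.rfl (fun hv => ?_) fun _ => rfl
    subst hv
    simp only [hrot]
  simp only [Matrix.trace, Matrix.diag, diag]
  rw [Finset.sum_comm]
  simp

/-- A bit as an element of `ℤ/2ℤ`. -/
def bit (b : Bool) : ZMod 2 := if b then 1 else 0

/-- The Pauli label that is encoded by the outcome of the `k`-th Bell measurement. -/
def outcome {n : ℕ} (O : TelepQubit n → Bool) (k : Fin n) : PauliIndex :=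
  (bit (O (k, 1)), bit (O (k, 0)))

/-- This is the local contribution of one Bell measurement: the outcome `(z, x)` inserts a Pauli
matrix after the transposed gate. -/
theorem hGate_mul_entry (C : Matrix Bool Bool ℂ) (x z a b : Bool) :
    hGate z (b ^^ x) * C (b ^^ x) a =
      1 / (Real.sqrt 2 : ℂ) * (C.transpose * pauliMatrix (bit x, bit z)) a b := by
  cases x <;> cases z <;> cases b <;>
    simp [bit, pauliMatrix_zero_zero, pauliMatrix_zero_one, pauliMatrix_one_zero,
      pauliMatrix_one_one, mat2, hGate, Matrix.mul_apply]

/-- The qubits are enumerated by Bell pair instead of by measured pair, which is the grouping used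
in the preparation layers. -/
theorem forall_telepQubit {n : ℕ} {p : TelepQubit n → Prop} :
    (∀ q, p q) ↔ ∀ k : Fin n, p (partner k) ∧ p (k, 0) := by
  refine ⟨fun h k => ⟨h _, h _⟩, fun h ⟨k, i⟩ => ?_⟩
  fin_cases i
  · exact (h k).2
  · have := (h (finRotate n k)).1
    rwa [partner, Equiv.symm_apply_apply] at this

/-- Decidability instances are left to unification, because those in `QLayer.unitary` are classical.
-/
theorem if_congr_of_iff {α : Sort*} {b c : Prop} {hb : Decidable b} {hc : Decidable c} {x y u v : α}
    (h : b ↔ c) (hx : x = u) (hy : y = v) : ite b x y = ite c u v :=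
  if_congr h hx hy

/-- The layer permutes basis states by an involution, so amplitudes are pulled back along the very
same map. -/
theorem prepCNOT_mulVec (n : ℕ) (I : Fin n × Fin 5 → Bool) (ψ : (TelepQubit n → Bool) → ℂ)
    (x : TelepQubit n → Bool) : ((prepCNOT n).unitary I).mulVec ψ x =
      ψ fun q => if q.2 = 0 then x (partner q.1) ^^ x q else x q := by
  have hU : ∀ y, (prepCNOT n).unitary I x y =
      if y = (fun q => if q.2 = 0 then x (partner q.1) ^^ x q else x q) then 1 else 0 := by
    intro y
    rw [QLayer.unitary, if_pos]
    · trans ∏ k, if x (partner k) = y (partner k) ∧ x (k, 0) = (y (partner k) ^^ y (k, 0)) then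
          (1 : ℂ) else 0
      · rfl
      rw [Fintype.prod_ite_zero, Finset.prod_const_one]
      refine if_congr_of_iff (.symm <| funext_iff.trans <| forall_telepQubit.trans <|
        forall_congr' fun k => ?_) rfl rfl
      have hp : (partner k).2 ≠ 0 := by simp [partner]
      rw [if_neg hp, if_pos rfl]
      cases x (partner k) <;> cases y (partner k) <;> cases x (k, 0) <;> cases y (k, 0) <;> simp
    · rw [forall_telepQubit]
      exact fun k => ⟨fun h => absurd rfl (h k (0 : Fin 2)), fun h => absurd rfl (h k (1 : Fin 2))⟩
  simp [Matrix.mulVec, dotProduct, hU]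

theorem measureCNOT_mulVec (n : ℕ) (I : Fin n × Fin 5 → Bool) (ψ : (TelepQubit n → Bool) → ℂ)
    (x : TelepQubit n → Bool) : ((measureCNOT n).unitary I).mulVec ψ x =
      ψ fun q => if q.2 = 0 then x q else x (q.1, 0) ^^ x q := by
  have hU : ∀ y, (measureCNOT n).unitary I x y =
      if y = (fun q => if q.2 = 0 then x q else x (q.1, 0) ^^ x q) then 1 else 0 := by
    intro y
    have hq : ∀ p : TelepQubit n → Prop, (∀ q, p q) ↔ ∀ k : Fin n, p (k, 0) ∧ p (k, 1) :=
      fun p => by simp [Prod.forall, Fin.forall_fin_two]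
    rw [QLayer.unitary, if_pos]
    · trans ∏ k : Fin n, if x (k, 0) = y (k, 0) ∧ x (k, 1) = (y (k, 0) ^^ y (k, 1)) then
          (1 : ℂ) else 0
      · rfl
      rw [Fintype.prod_ite_zero, Finset.prod_const_one]
      refine if_congr_of_iff (.symm <| funext_iff.trans <| (hq _).trans <|
        forall_congr' fun k => ?_) rfl rfl
      rw [if_neg one_ne_zero, if_pos rfl]
      cases x (k, 0) <;> cases y (k, 0) <;> cases x (k, 1) <;> cases y (k, 1) <;> simp
    · rw [hq]
      exact fun k => ⟨fun h => absurd rfl (h k (0 : Fin 2)), fun h => absurd rfl (h k (1 : Fin 2))⟩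
  simp [Matrix.mulVec, dotProduct, hU]

theorem prepH_mulVec_zeroState (n : ℕ) (I : Fin n × Fin 5 → Bool) (x : TelepQubit n → Bool) :
    ((prepH n).unitary I).mulVec (zeroState _) x =
      if ∀ k : Fin n, x (k, 0) = false then (1 / (Real.sqrt 2 : ℂ)) ^ n else 0 := by
  rw [zeroState, Matrix.mulVec_single_one, Matrix.col_apply, QLayer.unitary]
  refine if_congr_of_iff ?_ ?_ rfl
  · rw [forall_telepQubit]
    refine forall_congr' fun k => ⟨fun h => h.2 fun l _ h' => partner_ne l k h', fun h =>
      ⟨fun h' => absurd rfl (h' k (0 : Fin 1)), fun _ => h⟩⟩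
  · trans ∏ k : Fin n, hGate (x (partner k)) false
    · rfl
    rw [← Fin.prod_const]
    refine Finset.prod_congr rfl fun k _ => ?_
    cases x (partner k) <;> rfl

theorem measureH_unitary_apply (n : ℕ) (I : Fin n × Fin 5 → Bool) (x y : TelepQubit n → Bool) :
    (measureH n).unitary I x y = if ∀ k : Fin n, x (k, 1) = y (k, 1) then
      ∏ k : Fin n, hGate (x (k, 0)) (y (k, 0)) else 0 := by
  rw [QLayer.unitary]
  refine if_congr_of_iff ⟨fun h k => h _ fun l _ h' => ?_, fun h ⟨k, i⟩ h' => ?_⟩ rfl rfl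
  · exact absurd (congrArg Prod.snd h') zero_ne_one
  · fin_cases i
    exacts [absurd rfl (h' k (0 : Fin 1)), h k]

theorem cliffordLayer_unitary_apply (e : Clifford ↪ (Fin 5 → Bool)) {n : ℕ}
    (C : Fin n → Clifford) (x y : TelepQubit n → Bool) :
    (cliffordLayer e n).unitary (encode e C) x y = if ∀ k : Fin n, x (k, 1) = y (k, 1) then
      ∏ k : Fin n, (C k).toMatrix (x (k, 0)) (y (k, 0)) else 0 := by
  rw [QLayer.unitary]
  refine if_congr_of_iff ⟨fun h k => h _ fun l _ h' => ?_, fun h ⟨k, i⟩ h' => ?_⟩ ?_ rfl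
  · exact absurd (congrArg Prod.snd h') zero_ne_one
  · fin_cases i
    exacts [absurd rfl (h' k (0 : Fin 1)), h k]
  · refine Finset.prod_congr rfl fun k _ => ?_
    rw [← e.injective.extend_apply Clifford.toMatrix (fun _ => 1) (C k)]
    rfl

/-- The state before the Bell measurements. -/
theorem teleported_state (e : Clifford ↪ (Fin 5 → Bool)) {n : ℕ} (C : Fin n → Clifford)
    (x : TelepQubit n → Bool) :
    ((cliffordLayer e n).unitary (encode e C)).mulVec
      (((prepCNOT n).unitary (encode e C)).mulVec
        (((prepH n).unitary (encode e C)).mulVec (zeroState _))) x =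
      (1 / (Real.sqrt 2 : ℂ)) ^ n * ∏ k, (C k).toMatrix (x (k, 0)) (x (partner k)) := by
  have hp : ∀ k : Fin n, (partner k).2 ≠ 0 := by simp [partner]
  -- Only one intermediate basis state contributes: the Clifford layer fixes the bits `(k, 1)`, and
  -- the two bits of a Bell pair agree.
  rw [Matrix.mulVec, dotProduct,
    Finset.sum_eq_single fun q => if q.2 = 0 then x (partner q.1) else x q]
  · rw [cliffordLayer_unitary_apply, prepCNOT_mulVec, prepH_mulVec_zeroState, if_pos, if_pos,
      mul_comm]
    · rfl
    · intro k
      simp [hp]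
    · exact fun k => rfl
  · intro y _ hy
    rw [cliffordLayer_unitary_apply, prepCNOT_mulVec, prepH_mulVec_zeroState, mul_eq_zero]
    by_contra! h
    have h1 := (ite_ne_right_iff.1 h.1).1
    have h2 := (ite_ne_right_iff.1 h.2).1
    refine hy (funext (forall_telepQubit.2 fun k => ?_))
    have h3 := h2 k
    have h4 : x (partner k) = y (partner k) := h1 _
    rw [if_neg (hp k), if_pos rfl, h4]
    revert h3
    cases y (partner k) <;> cases y (k, 0) <;> simp
  · simp

theorem telep_finalState (e : Clifford ↪ (Fin 5 → Bool)) {n : ℕ} (C : Fin n → Clifford)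
    (O : TelepQubit n → Bool) :
    (telep e n).finalState (encode e C) O = (1 / (Real.sqrt 2 : ℂ)) ^ (n + n) *
      ∑ v : Fin n → Bool, ∏ k, ((C k).toMatrix.transpose * pauliMatrix (outcome O k))
        (v ((finRotate n).symm k)) (v k) := by
  rw [Finset.mul_sum]
  symm
  change _ = ∑ y, (measureH n).unitary (encode e C) O y *
    ((measureCNOT n).unitary (encode e C)).mulVec
      (((cliffordLayer e n).unitary (encode e C)).mulVec
        (((prepCNOT n).unitary (encode e C)).mulVec
          (((prepH n).unitary (encode e C)).mulVec (zeroState _)))) y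
  -- Here `v k` is the bit of qubit `(k, 1)` in the state before the measurement CNOTs. Its Bell
  -- partner is `(k + 1, 0)`, so the gate of index `k + 1` links `v k` to `v (k + 1)` and the walk
  -- closes up.
  refine Finset.sum_of_injOn (fun v q => if q.2 = 0 then v q.1 ^^ O (q.1, 1) else O q)
    ?_ (fun _ _ => Finset.mem_coe.2 (Finset.mem_univ _)) ?_ ?_
  · intro v _ w _ h
    funext k
    simpa using congrFun h (k, 0)
  · intro y _ hy
    rw [measureH_unitary_apply, if_neg, zero_mul]
    intro h
    refine hy ⟨fun k => y (k, 0) ^^ O (k, 1), Finset.mem_coe.2 (Finset.mem_univ _), ?_⟩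
    funext ⟨k, i⟩
    fin_cases i
    · simp
    · exact h k
  · intro v _
    rw [measureH_unitary_apply, if_pos fun k => (if_neg one_ne_zero).symm, measureCNOT_mulVec,
      teleported_state, mul_left_comm, ← Finset.prod_mul_distrib, pow_add, mul_assoc]
    congr 1
    rw [← Fin.prod_const, ← Finset.prod_mul_distrib]
    refine Finset.prod_congr rfl fun k _ => ?_
    rw [outcome, ← hGate_mul_entry]
    simp [partner]

theorem PSIM_telep_iff (e : Clifford ↪ (Fin 5 → Bool)) {m : ℕ} (C : Fin (m + 1) → Clifford)
    (O : TelepQubit (m + 1) → Bool) : PSIM (telep e (m + 1)) (encode e C) O ↔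
      (List.ofFn fun k => (C k).toMatrix.transpose * pauliMatrix (outcome O k)).prod.trace ≠ 0 := by
  have h2 : (1 / (Real.sqrt 2 : ℂ)) ^ (m + 1 + (m + 1)) ≠ 0 := by simp
  rw [PSIM, QCircuit.outputProb, sq_pos_iff, norm_ne_zero_iff, telep_finalState,
    sum_prod_cycle_eq_trace, mul_ne_zero_iff, and_iff_right h2]

/-! ### Locality of shallow Boolean circuits -/

namespace BoolCircuit

variable {ι o : Type}

theorem exists_dependsOn_gateVal (C : BoolCircuit ι o) {ν : ℕ} (hν : ∀ g, C.fanIn g ≤ ν)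
    (d : ℕ) : ∀ g : Fin C.size, C.gateDepth g ≤ d →
      ∃ D : Finset ι, D.card ≤ (ν + 1) ^ d ∧
        ∀ x y : ι → Bool, (∀ i ∈ D, x i = y i) → C.gateVal x g = C.gateVal y g := by
  classical
  induction d with
  | zero =>
    intro g hg
    -- Vacuous: every gate has depth at least 1.
    rw [gateDepth] at hg
    omega
  | succ d ih =>
    intro g hg
    rw [gateDepth, add_comm, add_le_add_iff_right, Finset.sup_le_iff] at hg
    have hD : ∀ i : Fin (C.fanIn g), ∃ D : Finset ι, D.card ≤ (ν + 1) ^ d ∧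
        ∀ x y : ι → Bool, (∀ i ∈ D, x i = y i) →
          (match C.arg g i with
            | .inl j => x j
            | .inr h => C.gateVal x ⟨h, h.2.trans g.2⟩) =
          (match C.arg g i with
            | .inl j => y j
            | .inr h => C.gateVal y ⟨h, h.2.trans g.2⟩) := by
      intro i
      have hi := hg i (Finset.mem_univ i)
      cases h : C.arg g i with
      | inl j =>
        -- The base `ν + 1`, rather than `ν`, keeps the bound at least 1 even for `ν = 0`.
        exact ⟨{j}, by rw [Finset.card_singleton]; exact Nat.one_le_pow _ _ (Nat.succ_pos ν),
          fun x y hxy => hxy j (Finset.mem_singleton_self j)⟩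
      | inr k =>
        rw [h] at hi
        exact ih _ hi
    choose D hcard hval using hD
    refine ⟨Finset.univ.biUnion D, ?_, fun x y hxy => ?_⟩
    · calc (Finset.univ.biUnion D).card ≤ (Finset.univ : Finset (Fin (C.fanIn g))).card *
            (ν + 1) ^ d := Finset.card_biUnion_le_card_mul _ _ _ fun i _ => hcard i
        _ ≤ (ν + 1) ^ (d + 1) := by
          rw [Finset.card_univ, Fintype.card_fin, pow_succ, mul_comm]
          exact Nat.mul_le_mul_left _ ((hν g).trans (Nat.le_succ ν))
    · rw [gateVal, gateVal]
      congr 1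
      funext i
      exact hval i x y fun j hj => hxy j (Finset.mem_biUnion.2 ⟨i, Finset.mem_univ i, hj⟩)

/-- Each output bit of a circuit of depth `d` and fan-in `ν` depends on few input bits. -/
theorem exists_dependsOn_eval (C : BoolCircuit ι o) {d ν : ℕ} (hd : C.depth ≤ d)
    (hν : ∀ g, C.fanIn g ≤ ν) (k : o) :
    ∃ D : Finset ι, D.card ≤ (ν + 1) ^ d ∧
      ∀ x y : ι → Bool, (∀ i ∈ D, x i = y i) → C.eval x k = C.eval y k := by
  unfold eval
  cases C.out k with
  | inl j =>
    exact ⟨{j}, by rw [Finset.card_singleton]; exact Nat.one_le_pow _ _ (Nat.succ_pos ν),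
      fun x y hxy => hxy j (Finset.mem_singleton_self j)⟩
  | inr g =>
    exact C.exists_dependsOn_gateVal hν d g
      ((Finset.le_sup (f := C.gateDepth) (Finset.mem_univ g)).trans hd)

end BoolCircuit

/-! ### The magic-square contradiction -/

/-- If the sets `D j` are small, then some pair is contained in none of them. -/
theorem exists_lt_not_mem_of_card_le {n c : ℕ} (hn : c ^ 2 + 1 < n) (D : Fin n → Finset (Fin n))
    (hD : ∀ j, (D j).card ≤ c) : ∃ p q : Fin n, p < q ∧ ∀ j, p ∉ D j ∨ q ∉ D j := by
  by_contra! h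
  have hsub : (Finset.univ : Finset (Fin n)).offDiag ⊆
      Finset.univ.biUnion fun j => D j ×ˢ D j := by
    rintro ⟨p, q⟩ hpq
    simp only [Finset.mem_biUnion, Finset.mem_univ, true_and, Finset.mem_product]
    rcases lt_or_gt_of_ne (Finset.mem_offDiag.1 hpq).2.2 with hlt | hlt
    · exact h p q hlt
    · exact (h q p hlt).imp fun j => And.symm
  have hcard := (Finset.card_le_card hsub).trans <|
    Finset.card_biUnion_le_card_mul _ _ (c ^ 2) fun j _ => by
      rw [Finset.card_product, sq]
      exact Nat.mul_le_mul (hD j) (hD j)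
  -- The `n(n - 1)` ordered pairs would be covered by `n` squares of at most `c²` pairs each.
  rw [Finset.offDiag_card, Finset.card_univ, Fintype.card_fin, ← Nat.mul_sub_one] at hcard
  have := Nat.le_of_mul_le_mul_left hcard (by omega)
  omega

/-- The Clifford labels of `rotationGate`. -/
def rotationLabel : Fin 3 → Clifford := ![(.I, .I), (.I, .HS), (.I, .HSHS)]

/-- The Clifford labels of `reflectionGate`. -/
def reflectionLabel : Fin 3 → Clifford := ![(.I, .H), (.I, .S), (.I, .SHS)]

theorem Pauli.I_toMatrix : Pauli.I.toMatrix = 1 := by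
  ext i j
  cases i <;> cases j <;> simp [Pauli.toMatrix, mat2]

theorem transpose_hGate : hGate.transpose = hGate := transpose_mat2 _ _ _ _

theorem transpose_sGate : sGate.transpose = sGate := transpose_mat2 _ _ _ _

theorem Clifford.one_toMatrix_transpose :
    (Clifford.toMatrix (.I, .I)).transpose = 1 := by
  simp [Clifford.toMatrix, Pauli.I_toMatrix, CliffordRep.toMatrix]

theorem rotationLabel_toMatrix_transpose (a : Fin 3) :
    (rotationLabel a).toMatrix.transpose = rotationGate a := by
  fin_cases a <;> simp [rotationLabel, rotationGate, Clifford.toMatrix, Pauli.I_toMatrix,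
    CliffordRep.toMatrix, pow_two, Matrix.transpose_mul, transpose_hGate, transpose_sGate]

theorem reflectionLabel_toMatrix_transpose (b : Fin 3) :
    (reflectionLabel b).toMatrix.transpose = reflectionGate b := by
  fin_cases b <;> simp [reflectionLabel, reflectionGate, Clifford.toMatrix, Pauli.I_toMatrix,
    CliffordRep.toMatrix, Matrix.transpose_mul, transpose_hGate, transpose_sGate, mul_assoc]

/-- The instance with a rotation at `p`, a reflection at `q`, and identity gates elsewhere. -/
def magicInstance {n : ℕ} (p q : Fin n) (a b : Fin 3) (j : Fin n) : Clifford :=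
  if j = p then rotationLabel a else if j = q then reflectionLabel b else (.I, .I)

/-- The action on the `j`-th outcome of the gates of `magicInstance p q a b` after position `j`. -/
def magicAction {n : ℕ} (p q : Fin n) (a b : Fin 3) (j : Fin n) : PauliIndex →+ PauliIndex :=
  if j < p then (reflectionAction b).comp (rotationAction a)
  else if j < q then reflectionAction b else .id _

/-- On `magicInstance p q a b`, the outcomes of a valid output satisfy a linear equation. -/
theorem testForm_sum_magicAction (e : Clifford ↪ (Fin 5 → Bool)) {n : ℕ} {p q : Fin n}
    (hpq : p < q) (a b : Fin 3) (O : TelepQubit n → Bool)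
    (hO : PSIM (telep e n) (encode e (magicInstance p q a b)) O) :
    testForm a b (∑ j, magicAction p q a b j (outcome O j)) = testValue a b := by
  obtain ⟨m, rfl⟩ : ∃ m, n = m + 1 := ⟨n - 1, by have := p.pos; omega⟩
  rw [PSIM_telep_iff] at hO
  obtain ⟨c, hc⟩ := prod_mul_pauliMatrix
    (fun j => (magicInstance p q a b j).toMatrix.transpose) (outcome O)
    -- The product of the gates from `j` onwards; it changes only after `p` and after `q`.
    (fun j => if j ≤ p.castSucc then rotationGate a * reflectionGate b
      else if j ≤ q.castSucc then reflectionGate b else 1) (magicAction p q a b)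
    (by
      rw [if_neg, if_neg] <;> exact not_le.2 (Fin.castSucc_lt_last _))
    (by
      intro j
      simp only [Fin.castSucc_le_castSucc_iff, Fin.succ_le_castSucc_iff, magicInstance]
      rcases lt_trichotomy j p with hj | rfl | hj
      · rw [if_pos hj.le, if_pos hj, if_neg hj.ne, if_neg (hj.trans hpq).ne,
          Clifford.one_toMatrix_transpose, one_mul]
      · rw [if_pos le_rfl, if_neg (lt_irrefl j), if_pos rfl, if_pos hpq,
          rotationLabel_toMatrix_transpose]
      · rw [if_neg (not_le.2 hj), if_neg (not_lt.2 hj.le), if_neg hj.ne']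
        rcases lt_trichotomy j q with hj | rfl | hj
        · rw [if_pos hj.le, if_pos hj, if_neg hj.ne, Clifford.one_toMatrix_transpose, one_mul]
        · rw [if_pos le_rfl, if_neg (lt_irrefl j), if_pos rfl,
            reflectionLabel_toMatrix_transpose, mul_one]
        · rw [if_neg (not_le.2 hj), if_neg (not_lt.2 hj.le), if_neg hj.ne',
            Clifford.one_toMatrix_transpose, one_mul])
    (by
      intro j
      simp only [Fin.succ_le_castSucc_iff, magicAction]
      split_ifs
      · exact (commutesPauli_rotationGate a).mul (commutesPauli_reflectionGate b)
      · exact commutesPauli_reflectionGate b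
      · exact .one)
  -- The collected scalar need not be known: a nonzero total trace already forces the remaining
  -- trace to be nonzero.
  rw [hc, if_pos (Fin.zero_le _), Matrix.trace_smul, smul_ne_zero_iff] at hO
  exact testForm_eq_of_trace_ne_zero a b _ hO.2

/-- If every outcome depends on only one of the two varying gates, then some output is not valid:
the nine linear equations form a magic square. -/
theorem exists_not_PSIM_magicInstance (e : Clifford ↪ (Fin 5 → Bool)) {n : ℕ} {p q : Fin n}
    (hpq : p < q) (O : Fin 3 → Fin 3 → TelepQubit n → Bool)
    (hO : ∀ j : Fin n, (∃ f : Fin 3 → PauliIndex, ∀ a b, outcome (O a b) j = f b) ∨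
      ∃ f : Fin 3 → PauliIndex, ∀ a b, outcome (O a b) j = f a) :
    ∃ a b, ¬ PSIM (telep e n) (encode e (magicInstance p q a b)) (O a b) := by
  by_contra! h
  have hsum : ∑ a, ∑ b, testForm a b (∑ j, magicAction p q a b j (outcome (O a b) j)) = 1 := by
    rw [← testValue_sum]
    exact Finset.sum_congr rfl fun a _ => Finset.sum_congr rfl fun b _ =>
      testForm_sum_magicAction e hpq a b (O a b) (h a b)
  refine absurd hsum ?_
  simp only [map_sum]
  -- With the sum over positions outermost, each outcome's contribution over the square can be
  -- cancelled separately.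
  rw [Finset.sum_congr rfl fun a _ => Finset.sum_comm, Finset.sum_comm,
    Finset.sum_eq_zero fun j _ => ?_]
  · exact zero_ne_one
  · rcases hO j with ⟨f, hf⟩ | ⟨f, hf⟩
    · rw [Finset.sum_comm]
      refine Finset.sum_eq_zero fun b _ => ?_
      obtain ⟨h0, h1, h2⟩ := sum_left_testForm b (f b)
      simp only [hf, magicAction]
      split_ifs
      exacts [h2, h1, h0]
    · refine Finset.sum_eq_zero fun a _ => ?_
      obtain ⟨h0, h1, h2⟩ := sum_right_testForm a (f a)
      simp only [hf, magicAction]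
      split_ifs
      exacts [h2, h1, h0]

/-- A circuit of bounded depth and fan-in fails on some instance, if it is large enough. -/
theorem exists_not_PSIM_eval (e : Clifford ↪ (Fin 5 → Bool)) {n d ν : ℕ}
    (hn : ((ν + 1) ^ d + (ν + 1) ^ d) ^ 2 + 1 < n)
    (F : BoolCircuit (Fin n × Fin 5) (TelepQubit n)) (hd : F.depth ≤ d)
    (hν : ∀ g, F.fanIn g ≤ ν) :
    ∃ C : Fin n → Clifford, ¬ PSIM (telep e n) (encode e C) (F.eval (encode e C)) := by
  choose D hcard hD using F.exists_dependsOn_eval hd hν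
  -- Bits are projected to their input blocks; an outcome consists of two output bits, hence twice
  -- the bound for one bit.
  obtain ⟨p, q, hpq, hdisj⟩ := exists_lt_not_mem_of_card_le hn
    (fun j => (D (j, 1)).image Prod.fst ∪ (D (j, 0)).image Prod.fst) fun j =>
      (Finset.card_union_le _ _).trans <|
        add_le_add (Finset.card_image_le.trans (hcard _)) (Finset.card_image_le.trans (hcard _))
  have hout : ∀ (r j : Fin n),
      r ∉ (D (j, 1)).image Prod.fst ∪ (D (j, 0)).image Prod.fst →
      ∀ C C' : Fin n → Clifford, (∀ i, i ≠ r → C i = C' i) →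
        outcome (F.eval (encode e C)) j = outcome (F.eval (encode e C')) j := by
    intro r j hr C C' hC
    rw [Finset.mem_union, not_or] at hr
    have key : ∀ k, r ∉ (D k).image Prod.fst →
        F.eval (encode e C) k = F.eval (encode e C') k := fun k hk =>
      hD k _ _ fun i hi => by
        rw [encode, encode, hC]
        rintro rfl
        exact hk (Finset.mem_image_of_mem _ hi)
    rw [outcome, outcome, key _ hr.1, key _ hr.2]
  obtain ⟨a, b, h⟩ := exists_not_PSIM_magicInstance e hpq
    (fun a b => F.eval (encode e (magicInstance p q a b))) fun j => by
      -- An outcome blind to one position is a function of the other choice alone, obtained by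
      -- freezing the unseen choice at 0.
      refine (hdisj j).imp (fun hj => ⟨_, fun a b => hout p j hj _ (magicInstance p q 0 b) ?_⟩)
        fun hj => ⟨_, fun a b => hout q j hj _ (magicInstance p q a 0) ?_⟩
      · intro i hi
        rw [magicInstance, magicInstance, if_neg hi, if_neg hi]
      · intro i hi
        rw [magicInstance, magicInstance, if_neg hi, if_neg hi]
  exact ⟨_, h⟩

end GateTeleportation
end

theorem theorem1 (e : Clifford ↪ (Fin 5 → Bool)) :
    -- The quantum circuit has constant depth and solves its own possibilistic simulation problem.
    (∀ n : ℕ, (telep e n).depth = 5 ∧ (telep e n).ControlBound 5 ∧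
      ∀ C : Fin n → Clifford, (telep e n).SolvesOn (PSIM (telep e n)) (encode e C)) ∧
    -- Every family of constant-depth, bounded-fan-in classical circuits fails on some instance.
    (∀ F : (n : ℕ) → BoolCircuit (Fin n × Fin 5) (TelepQubit n), ConstDepthBoundedFanIn F →
      ∃ (n : ℕ) (C : Fin n → Clifford),
        ¬ PSIM (telep e n) (encode e C) ((F n).eval (encode e C))) ∧
    -- In particular, the problem is not solved by any non-uniform circuit family in `NC⁰`.
    (¬ ∃ F : (n : ℕ) → BoolCircuit (Fin n × Fin 5) (TelepQubit n), IsNC0 F ∧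
      ∀ (n : ℕ) (C : Fin n → Clifford),
        PSIM (telep e n) (encode e C) ((F n).eval (encode e C))) := by
  have hard : ∀ F : (n : ℕ) → BoolCircuit (Fin n × Fin 5) (TelepQubit n),
      ConstDepthBoundedFanIn F → ∃ (n : ℕ) (C : Fin n → Clifford),
        ¬ PSIM (telep e n) (encode e C) ((F n).eval (encode e C)) := by
    rintro F ⟨d, ν, hF⟩
    exact ⟨_, exists_not_PSIM_eval e (Nat.lt_succ_self _) (F _) (hF _).1 (hF _).2⟩
  refine ⟨fun n => ⟨rfl, telep_controlBound e n, fun C => (telep e n).solvesOn_PSIM _⟩, hard, ?_⟩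
  rintro ⟨F, ⟨hF, -⟩, hsolve⟩
  obtain ⟨n, C, h⟩ := hard F hF
  exact h (hsolve n C)
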